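/- A real function $f$ on an interval $I\subseteq\mathbb R$ is called $n$-monotone on $I$ if $f(A)\le f(B)$ for all self-adjoint complex $n\times n$ matrices $A\le B$ whose eigenvalues lie in $I$, and $n$-convex on $I$ if $f(\lambda A+(1-\lambda)B)\le \lambda f(A)+(1-\lambda)f(B)$ for all self-adjoint complex $n\times n$ matrices $A,B$ whose eigenvalues lie in $I$ and all $\lambda\in[0,1]$; here $f(A)$ is defined by the functional calculus and $\le$ is the Loewner order. Theorem. For every $\alpha>0$ there is a $2$-monotone function $g$ on $(0,\alpha)$ such that the function $f(t)=t\,g(t)$ (with $f(0)=0$) is not $2$-convex on $[0,\alpha)$. More precisely, there are a real polynomial $P$ of degree $5$ and a number $\beta>0$, both independent of $\alpha$, such that for every $\alpha>0$ one can choose $g$ with $t\,g(t)=P(\beta t/\alpha)$ for all $t\in[0,\alpha)$ (so that in particular $P(0)=0$). -/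

import Mathlib

open scoped ComplexOrder

/-- `f` is matrix monotone of order `n` (`n`-monotone) on `I`: for all self-adjoint complex
`n × n` matrices `A ≤ B` (Loewner order) with all eigenvalues in `I`, one has `f(A) ≤ f(B)`,
where `f(A)` is given by the functional calculus. -/
def IsMatrixMonotoneOn (n : ℕ) (I : Set ℝ) (f : ℝ → ℝ) : Prop :=
  ∀ A B : Matrix (Fin n) (Fin n) ℂ, A.IsHermitian → B.IsHermitian →
    spectrum ℝ A ⊆ I → spectrum ℝ B ⊆ I →
    (B - A).PosSemidef → (cfc f B - cfc f A).PosSemidef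

/-- `f` is matrix convex of order `n` (`n`-convex) on `I`: for all self-adjoint complex
`n × n` matrices `A`, `B` with all eigenvalues in `I` and all `c ∈ [0, 1]`, one has
`f(c A + (1 - c) B) ≤ c f(A) + (1 - c) f(B)` in the Loewner order. -/
def IsMatrixConvexOn (n : ℕ) (I : Set ℝ) (f : ℝ → ℝ) : Prop :=
  ∀ A B : Matrix (Fin n) (Fin n) ℂ, A.IsHermitian → B.IsHermitian →
    spectrum ℝ A ⊆ I → spectrum ℝ B ⊆ I →
    ∀ c : ℝ, c ∈ Set.Icc (0 : ℝ) 1 →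
      (c • cfc f A + (1 - c) • cfc f B - cfc f (c • A + (1 - c) • B)).PosSemidef

/-!
The derivative of a polynomial `p` along a segment of self-adjoint matrices is, in an eigenbasis,
the Hadamard product of the Loewner matrix of `p` at the eigenvalues with the direction. By the
Schur product theorem, `p` is therefore `n`-monotone on an interval where its Loewner matrices of
size `n` are positive semidefinite.

For `q = X + X ^ 3 + X ^ 4` and `n = 2` this amounts near the diagonal to
`(q'' / 2) ^ 2 ≤ q' * (q''' / 6)`, which holds up to about `0.39`. Kraus's local condition for the
`2`-convexity of `p = X * q`, namely `(p''' / 6) ^ 2 ≤ (p'' / 2) * (p'''' / 24)`, already fails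
below `3 / 8`, and rescaling `[0, 3 / 8)` to `[0, α)` gives the theorem.
-/

open Matrix Polynomial Set
open scoped MatrixOrder

section Spectrum

variable {R : Type*} [Ring R] [StarRing R] [Algebra ℝ R] [PartialOrder R] [StarOrderedRing R]
  [TopologicalSpace R] [ContinuousFunctionalCalculus ℝ R IsSelfAdjoint] [NonnegSpectrumClass ℝ R]

lemma spectrum_subset_Icc_iff {a : R} (ha : IsSelfAdjoint a) {m M : ℝ} :
    spectrum ℝ a ⊆ Icc m M ↔ algebraMap ℝ R m ≤ a ∧ a ≤ algebraMap ℝ R M := by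
  rw [algebraMap_le_iff_le_spectrum ha, le_algebraMap_iff_spectrum_le ha]
  simp only [Set.subset_def, mem_Icc, forall₂_and]

lemma spectrum_smul_add_smul_subset [StarModule ℝ R] [PosSMulMono ℝ R]
    {I : Set ℝ} (hI : I.OrdConnected) {a b : R}
    (ha : IsSelfAdjoint a) (hb : IsSelfAdjoint b) (haI : spectrum ℝ a ⊆ I)
    (hbI : spectrum ℝ b ⊆ I) {u v : ℝ} (hu : 0 ≤ u) (hv : 0 ≤ v) (huv : u + v = 1) :
    spectrum ℝ (u • a + v • b) ⊆ I := by
  rcases subsingleton_or_nontrivial R with _ | _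
  · simp [spectrum.of_subsingleton]
  set K := spectrum ℝ a ∪ spectrum ℝ b
  have hK : IsCompact K := (ContinuousFunctionalCalculus.isCompact_spectrum a).union
    (ContinuousFunctionalCalculus.isCompact_spectrum b)
  have hne : K.Nonempty := (ContinuousFunctionalCalculus.spectrum_nonempty a ha).inl
  obtain ⟨m, hm, hmK⟩ := hK.exists_isLeast hne
  obtain ⟨M, hM, hMK⟩ := hK.exists_isGreatest hne
  have hKI : K ⊆ I := union_subset haI hbI
  have hKm : K ⊆ Icc m M := fun x hx => ⟨hmK hx, hMK hx⟩
  obtain ⟨hma, haM⟩ := (spectrum_subset_Icc_iff ha).1 (subset_union_left.trans hKm)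
  obtain ⟨hmb, hbM⟩ := (spectrum_subset_Icc_iff hb).1 (subset_union_right.trans hKm)
  have hcombo (r : ℝ) : algebraMap ℝ R r = u • algebraMap ℝ R r + v • algebraMap ℝ R r := by
    rw [← add_smul, huv, one_smul]
  refine ((spectrum_subset_Icc_iff ?_).2 ⟨?_, ?_⟩).trans (hI.out (hKI hm) (hKI hM))
  · exact ((IsSelfAdjoint.all u).smul ha).add ((IsSelfAdjoint.all v).smul hb)
  · rw [hcombo m]; gcongr
  · rw [hcombo M]; gcongr

end Spectrum

theorem monotoneOn_of_hasDerivAt_nonneg {E : Type*} [NormedAddCommGroup E] [NormedSpace ℝ E]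
    [PartialOrder E] [IsOrderedAddMonoid E] [PosSMulMono ℝ E] [OrderClosedTopology E]
    {D : Set ℝ} (hD : Convex ℝ D) {f f' : ℝ → E} (hf : ∀ x ∈ D, HasDerivAt f (f' x) x)
    (hf' : ∀ x ∈ D, 0 ≤ f' x) : MonotoneOn f D := by
  intro a ha b hb hab
  by_contra hlt
  have hnot : f b - f a ∉ ProperCone.positive ℝ E := by simpa using hlt
  obtain ⟨φ, hφ, hφlt⟩ := ProperCone.hyperplane_separation_point _ hnot
  have hderiv (x : ℝ) (hx : x ∈ D) : HasDerivAt (φ ∘ f) (φ (f' x)) x :=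
    φ.hasFDerivAt.comp_hasDerivAt x (hf x hx)
  have hmono : MonotoneOn (φ ∘ f) D := monotoneOn_of_deriv_nonneg hD
    (fun x hx => (hderiv x hx).continuousAt.continuousWithinAt)
    (fun x hx => (hderiv x (interior_subset hx)).differentiableAt.differentiableWithinAt)
    (fun x hx => by
      rw [(hderiv x (interior_subset hx)).deriv]
      exact hφ _ (hf' x (interior_subset hx)))
  have hφab : φ (f a) ≤ φ (f b) := hmono ha hb hab
  rw [map_sub] at hφlt
  linarith

section DividedDifference

variable {𝕜 E : Type*} [NontriviallyNormedField 𝕜] [NormedAddCommGroup E] [NormedSpace 𝕜 E]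

lemma dslope_const (c : E) (a b : 𝕜) : dslope (fun _ => c) a b = 0 := by
  rcases eq_or_ne b a with rfl | hab
  · rw [dslope_same, deriv_const]
  · rw [dslope_of_ne _ hab, slope_def_module, sub_self, smul_zero]

lemma dslope_id (a b : 𝕜) : dslope (fun x => x) a b = 1 := by
  rcases eq_or_ne b a with rfl | hab
  · rw [dslope_same, deriv_id'']
  · rw [dslope_of_ne _ hab, slope_def_field, div_self (sub_ne_zero.2 hab)]

lemma dslope_add {f g : 𝕜 → E} {a : 𝕜} (hf : DifferentiableAt 𝕜 f a)
    (hg : DifferentiableAt 𝕜 g a) (b : 𝕜) :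
    dslope (fun x => f x + g x) a b = dslope f a b + dslope g a b := by
  rcases eq_or_ne b a with rfl | hab
  · simp only [dslope_same, deriv_fun_add hf hg]
  · simp only [dslope_of_ne _ hab, slope_def_module]
    module

lemma dslope_mul {𝔸 : Type*} [NormedRing 𝔸] [NormedAlgebra 𝕜 𝔸] {f g : 𝕜 → 𝔸} {a : 𝕜}
    (hf : DifferentiableAt 𝕜 f a) (hg : DifferentiableAt 𝕜 g a) (b : 𝕜) :
    dslope (fun x => f x * g x) a b = f a * dslope g a b + dslope f a b * g b := by
  rcases eq_or_ne b a with rfl | hab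
  · simp only [dslope_same, deriv_fun_mul hf hg, add_comm]
  · simp only [dslope_of_ne _ hab, slope_def_module, mul_smul_comm, smul_mul_assoc, ← smul_add]
    congr 1
    noncomm_ring

end DividedDifference

/-- The Loewner matrix of `f` at the nodes `d`: the `(i, j)` entry is the first divided difference
of `f` at `d i` and `d j`, which is the derivative of `f` when the nodes coincide. The real entries
are regarded as complex, so that Hadamard products with complex matrices make sense. -/
noncomputable def loewnerMatrix {ι : Type*} (f : ℝ → ℝ) (d : ι → ℝ) : Matrix ι ι ℂ :=
  .of fun i j => ((dslope f (d i) (d j) : ℝ) : ℂ)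

section Loewner

variable {ι : Type*} [Fintype ι] [DecidableEq ι]

lemma aeval_diagonal_ofReal (p : ℝ[X]) (d : ι → ℝ) :
    aeval (diagonal fun i => (d i : ℂ)) p = diagonal fun i => ((p.eval (d i) : ℝ) : ℂ) := by
  refine (aeval_algHom_apply (diagonalAlgHom ℝ) (fun i => (d i : ℂ)) p).trans ?_
  simp only [diagonalAlgHom_apply, aeval_pi_apply, diagonal_eq_diagonal_iff]
  exact fun i => (ofReal_eval p (d i)).symm

open scoped Matrix.Norms.L2Operator

lemma hasDerivAt_aeval_diagonal_add_smul (p : ℝ[X]) (d : ι → ℝ) (H : Matrix ι ι ℂ) :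
    HasDerivAt (fun s : ℝ => aeval (diagonal (fun i => (d i : ℂ)) + s • H) p)
      (loewnerMatrix p.eval d ⊙ H) 0 := by
  induction p using Polynomial.induction_on with
  | C c =>
    convert! hasDerivAt_const (0 : ℝ) (algebraMap ℝ (Matrix ι ι ℂ) c) using 1
    · simp
    · ext i j
      simp [loewnerMatrix, dslope_const]
  | add p q hp hq =>
    convert! hp.add hq using 1
    · ext1 s
      simp
    · ext i j
      simp [loewnerMatrix, dslope_add p.differentiableAt q.differentiableAt, add_mul]
  | monomial n c h =>
    rw [pow_succ, ← mul_assoc]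
    generalize C c * X ^ n = q at h ⊢
    have hline : HasDerivAt (fun s : ℝ => diagonal (fun i => (d i : ℂ)) + s • H) H 0 := by
      simpa using ((hasDerivAt_id (0 : ℝ)).smul_const H).const_add (diagonal fun i => (d i : ℂ))
    convert! h.mul hline using 1
    · ext1 s
      simp
    · ext i j
      simp only [loewnerMatrix, eval_mul, eval_X, dslope_id, mul_one, Complex.ofReal_add,
        dslope_mul q.differentiableAt differentiableAt_fun_id, Complex.ofReal_mul, hadamard_apply,
        of_apply, zero_smul, add_zero, aeval_diagonal_ofReal, Matrix.add_apply, mul_diagonal,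
        diagonal_mul]
      ring

lemma hasDerivAt_aeval_add_smul (p : ℝ[X]) {A : Matrix ι ι ℂ} (hA : A.IsHermitian)
    (H : Matrix ι ι ℂ) :
    HasDerivAt (fun s : ℝ => aeval (A + s • H) p)
      (hA.eigenvectorUnitary * (loewnerMatrix p.eval hA.eigenvalues ⊙
        (star (hA.eigenvectorUnitary : Matrix ι ι ℂ) * H * hA.eigenvectorUnitary)) *
        star (hA.eigenvectorUnitary : Matrix ι ι ℂ)) 0 := by
  set U := hA.eigenvectorUnitary
  set φ := Unitary.conjStarAlgAut ℝ (Matrix ι ι ℂ) U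
  have hφ (s : ℝ) : A + s • H =
      φ (diagonal (fun i => (hA.eigenvalues i : ℂ)) +
        s • (star (U : Matrix ι ι ℂ) * H * U)) := by
    rw [map_add, map_smul]
    congr 1
    · exact hA.spectral_theorem
    · have hU : (U : Matrix ι ι ℂ) * star (U : Matrix ι ι ℂ) = 1 :=
        Unitary.mul_star_self_of_mem U.2
      rw [Unitary.conjStarAlgAut_apply, ← mul_assoc, ← mul_assoc, hU, one_mul, mul_assoc, hU,
        mul_one]
  have haeval (M : Matrix ι ι ℂ) : aeval (φ M) p = U * aeval M p * star (U : Matrix ι ι ℂ) :=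
    aeval_algHom_apply φ M p
  simp only [hφ, haeval]
  exact ((hasDerivAt_aeval_diagonal_add_smul p _ _).const_mul (U : Matrix ι ι ℂ)).mul_const
    (star (U : Matrix ι ι ℂ))

lemma exists_nonneg_hasDerivAt_aeval_add_smul {p : ℝ[X]} {A H : Matrix ι ι ℂ} {s : ℝ}
    (hs : (A + s • H).IsHermitian) (hp : (loewnerMatrix p.eval hs.eigenvalues).PosSemidef)
    (hH : 0 ≤ H) :
    ∃ D : Matrix ι ι ℂ, 0 ≤ D ∧ HasDerivAt (fun r : ℝ => aeval (A + r • H) p) D s := by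
  set U : Matrix ι ι ℂ := ↑hs.eigenvectorUnitary
  refine ⟨U * (loewnerMatrix p.eval hs.eigenvalues ⊙ (star U * H * U)) * star U, ?_, ?_⟩
  · have hUH : (star U * H * U).PosSemidef :=
      (nonneg_iff_posSemidef.1 hH).conjTranspose_mul_mul_same U
    exact nonneg_iff_posSemidef.2 ((hp.hadamard hUH).mul_mul_conjTranspose_same U)
  · have hshift (r : ℝ) : A + r • H = A + s • H + (r - s) • H := by module
    have hderiv := hasDerivAt_aeval_add_smul p hs H
    rw [← sub_self s] at hderiv
    have hshifted := hderiv.comp_sub_const s s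
    simp only [← hshift] at hshifted
    exact hshifted

lemma aeval_le_aeval_of_posSemidef_loewnerMatrix {I : Set ℝ} (hI : I.OrdConnected) {p : ℝ[X]}
    (hp : ∀ d : ι → ℝ, (∀ i, d i ∈ I) → (loewnerMatrix p.eval d).PosSemidef)
    {A B : Matrix ι ι ℂ} (hA : A.IsHermitian) (hB : B.IsHermitian) (hAI : spectrum ℝ A ⊆ I)
    (hBI : spectrum ℝ B ⊆ I) (hAB : A ≤ B) :
    aeval A p ≤ aeval B p := by
  have hderiv : ∀ s ∈ Icc (0 : ℝ) 1, ∃ D : Matrix ι ι ℂ, 0 ≤ D ∧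
      HasDerivAt (fun r : ℝ => aeval (A + r • (B - A)) p) D s := by
    intro s ⟨hs0, hs1⟩
    have hcombo : A + s • (B - A) = (1 - s) • A + s • B := by module
    have hspec : spectrum ℝ (A + s • (B - A)) ⊆ I := by
      rw [hcombo]
      exact spectrum_smul_add_smul_subset hI hA.isSelfAdjoint hB.isSelfAdjoint hAI hBI
        (sub_nonneg.2 hs1) hs0 (sub_add_cancel 1 s)
    have hherm : (A + s • (B - A)).IsHermitian := hA.add ((hB.sub hA).smul (.all s))
    exact exists_nonneg_hasDerivAt_aeval_add_smul hherm
      (hp _ fun i => hspec (hherm.eigenvalues_mem_spectrum_real i)) (sub_nonneg.2 hAB)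
  choose! D hD hderivD using hderiv
  simpa using monotoneOn_of_hasDerivAt_nonneg (convex_Icc (0 : ℝ) 1) hderivD hD
    (left_mem_Icc.2 zero_le_one) (right_mem_Icc.2 zero_le_one) zero_le_one

end Loewner

theorem isMatrixMonotoneOn_of_posSemidef_loewnerMatrix {n : ℕ} {I : Set ℝ} (hI : I.OrdConnected)
    {p : ℝ[X]} (hp : ∀ d : Fin n → ℝ, (∀ i, d i ∈ I) → (loewnerMatrix p.eval d).PosSemidef) :
    IsMatrixMonotoneOn n I p.eval := by
  intro A B hA hB hAI hBI hAB
  rw [cfc_polynomial p A hA.isSelfAdjoint, cfc_polynomial p B hB.isSelfAdjoint]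
  exact aeval_le_aeval_of_posSemidef_loewnerMatrix hI hp hA hB hAI hBI hAB

lemma IsMatrixConvexOn.posSemidef_aeval {n : ℕ} {I : Set ℝ} {p : ℝ[X]}
    (hp : IsMatrixConvexOn n I p.eval) {A B : Matrix (Fin n) (Fin n) ℂ} (hA : A.IsHermitian)
    (hB : B.IsHermitian) (hAI : spectrum ℝ A ⊆ I) (hBI : spectrum ℝ B ⊆ I) {c : ℝ}
    (hc : c ∈ Icc (0 : ℝ) 1) :
    (c • aeval A p + (1 - c) • aeval B p - aeval (c • A + (1 - c) • B) p).PosSemidef := by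
  have hcombo : (c • A + (1 - c) • B).IsHermitian := (hA.smul (.all c)).add (hB.smul (.all _))
  rw [← cfc_polynomial p A hA.isSelfAdjoint, ← cfc_polynomial p B hB.isSelfAdjoint,
    ← cfc_polynomial p _ hcombo.isSelfAdjoint]
  exact hp A B hA hB hAI hBI c hc

section Rescaling

lemma spectrum_smul_subset {𝕜 R : Type*} [Field 𝕜] [Ring R] [Algebra 𝕜 R] {k : 𝕜} (hk : k ≠ 0)
    {I J : Set 𝕜} (hJI : MapsTo (k * ·) J I) {a : R} (ha : spectrum 𝕜 a ⊆ J) :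
    spectrum 𝕜 (k • a) ⊆ I := by
  have himage : spectrum 𝕜 (k • a) = (k * ·) '' spectrum 𝕜 a :=
    spectrum.unit_smul_eq_smul a (Units.mk0 k hk)
  rw [himage]
  exact (image_mono ha).trans hJI.image_subset

lemma cfc_comp_const_mul_of_isHermitian {ι : Type*} [Fintype ι] [DecidableEq ι] (k : ℝ)
    (f : ℝ → ℝ) {A : Matrix ι ι ℂ} (hA : A.IsHermitian) :
    cfc (fun t => f (k * t)) A = cfc f (k • A) :=
  cfc_comp_const_mul k f A ((finite_real_spectrum.image _).continuousOn f) hA.isSelfAdjoint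

variable {n : ℕ} {I J : Set ℝ} {f : ℝ → ℝ} {k : ℝ}

lemma IsMatrixMonotoneOn.const_mul (hf : IsMatrixMonotoneOn n I f) (hk : 0 ≤ k) :
    IsMatrixMonotoneOn n I (fun t => k * f t) := by
  intro A B hA hB hAI hBI hAB
  rw [cfc_const_mul k f A (finite_real_spectrum.continuousOn f),
    cfc_const_mul k f B (finite_real_spectrum.continuousOn f), ← smul_sub]
  exact (hf A B hA hB hAI hBI hAB).smul hk

lemma IsMatrixMonotoneOn.comp_const_mul (hf : IsMatrixMonotoneOn n I f) (hk : 0 < k)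
    (hJI : MapsTo (k * ·) J I) : IsMatrixMonotoneOn n J (fun t => f (k * t)) := by
  intro A B hA hB hAJ hBJ hAB
  rw [cfc_comp_const_mul_of_isHermitian k f hA, cfc_comp_const_mul_of_isHermitian k f hB]
  refine hf _ _ (hA.smul (.all k)) (hB.smul (.all k)) (spectrum_smul_subset hk.ne' hJI hAJ)
    (spectrum_smul_subset hk.ne' hJI hBJ) ?_
  rw [← smul_sub]
  exact hAB.smul hk.le

lemma IsMatrixConvexOn.comp_const_mul (hf : IsMatrixConvexOn n I f) (hk : k ≠ 0)
    (hJI : MapsTo (k * ·) J I) : IsMatrixConvexOn n J (fun t => f (k * t)) := by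
  intro A B hA hB hAJ hBJ c hc
  have hcombo : (c • A + (1 - c) • B).IsHermitian := (hA.smul (.all c)).add (hB.smul (.all _))
  rw [cfc_comp_const_mul_of_isHermitian k f hA, cfc_comp_const_mul_of_isHermitian k f hB,
    cfc_comp_const_mul_of_isHermitian k f hcombo, smul_add, smul_comm k c, smul_comm k (1 - c)]
  exact hf _ _ (hA.smul (.all k)) (hB.smul (.all k)) (spectrum_smul_subset hk hJI hAJ)
    (spectrum_smul_subset hk hJI hBJ) c hc

end Rescaling

section FinTwo

lemma posSemidef_fin_two {a d : ℝ} {b : ℂ} (ha : 0 ≤ a) (hd : 0 ≤ d) (h : ‖b‖ ^ 2 ≤ a * d) :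
    !![(a : ℂ), b; star b, d].PosSemidef := by
  rcases ha.eq_or_lt with rfl | ha
  · obtain rfl : b = 0 := by simpa using h
    convert PosSemidef.diagonal (d := ![0, (d : ℂ)]) ?_ using 1
    · ext i j
      fin_cases i <;> fin_cases j <;> simp
    · intro i
      fin_cases i <;> simp [hd]
  · have hschur : 0 ≤ d - ‖b‖ ^ 2 / a := by rwa [sub_nonneg, div_le_iff₀' ha]
    have hdiag : (diagonal ![0, ((d - ‖b‖ ^ 2 / a : ℝ) : ℂ)]).PosSemidef :=
      PosSemidef.diagonal fun i => by
        fin_cases i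
        · exact le_rfl
        · exact Complex.zero_le_real.2 hschur
    have hrankOne := (posSemidef_vecMulVec_self_star ![(a : ℂ), star b]).smul (inv_nonneg.2 ha.le)
    convert hrankOne.add hdiag using 1
    have ha' : (a : ℂ) ≠ 0 := Complex.ofReal_ne_zero.2 ha.ne'
    ext i j
    rw [Matrix.add_apply, Matrix.smul_apply, vecMulVec_apply, Pi.star_apply]
    fin_cases i <;> fin_cases j <;>
      simp [ha', ← Complex.conj_mul', div_eq_inv_mul, mul_comm _ (a : ℂ)]

lemma isHermitian_fin_two (a d : ℝ) (b : ℂ) : !![(a : ℂ), b; star b, d].IsHermitian := by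
  ext i j
  fin_cases i <;> fin_cases j <;> simp

lemma spectrum_fin_two_subset_Icc {a d m M : ℝ} {b : ℂ} (hma : m ≤ a) (hmd : m ≤ d)
    (haM : a ≤ M) (hdM : d ≤ M) (hm : ‖b‖ ^ 2 ≤ (a - m) * (d - m))
    (hM : ‖b‖ ^ 2 ≤ (M - a) * (M - d)) :
    spectrum ℝ !![(a : ℂ), b; star b, d] ⊆ Icc m M := by
  refine (spectrum_subset_Icc_iff (isHermitian_fin_two a d b).isSelfAdjoint).2 ⟨?_, ?_⟩
  · have hsub : !![(a : ℂ), b; star b, d] - algebraMap ℝ _ m =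
        !![((a - m : ℝ) : ℂ), b; star b, (d - m : ℝ)] := by
      ext i j
      fin_cases i <;> fin_cases j <;> simp [algebraMap_matrix_apply]
    rw [le_iff, hsub]
    exact posSemidef_fin_two (sub_nonneg.2 hma) (sub_nonneg.2 hmd) hm
  · have hsub : algebraMap ℝ _ M - !![(a : ℂ), b; star b, d] =
        !![((M - a : ℝ) : ℂ), -b; star (-b), (M - d : ℝ)] := by
      ext i j
      fin_cases i <;> fin_cases j <;> simp [algebraMap_matrix_apply]
    rw [le_iff, hsub]
    exact posSemidef_fin_two (sub_nonneg.2 haM) (sub_nonneg.2 hdM) (by rwa [norm_neg])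

lemma posSemidef_loewnerMatrix_fin_two {f : ℝ → ℝ} {d : Fin 2 → ℝ} (h0 : 0 ≤ deriv f (d 0))
    (h1 : 0 ≤ deriv f (d 1))
    (h : dslope f (d 0) (d 1) ^ 2 ≤ deriv f (d 0) * deriv f (d 1)) :
    (loewnerMatrix f d).PosSemidef := by
  have hsymm : dslope f (d 1) (d 0) = dslope f (d 0) (d 1) := by
    rcases eq_or_ne (d 0) (d 1) with h01 | h01
    · rw [h01]
    · rw [dslope_of_ne _ h01, dslope_of_ne _ h01.symm, slope_comm]
  convert posSemidef_fin_two (b := (dslope f (d 0) (d 1) : ℝ)) h0 h1 (by simpa using h) using 1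
  ext i j
  fin_cases i <;> fin_cases j <;> simp [loewnerMatrix, hsymm]

end FinTwo

section Quartic

lemma dslope_quartic (x y : ℝ) :
    dslope (X + X ^ 3 + X ^ 4 : ℝ[X]).eval x y =
      1 + (x ^ 2 + x * y + y ^ 2) + (x ^ 3 + x ^ 2 * y + x * y ^ 2 + y ^ 3) := by
  rcases eq_or_ne y x with rfl | hyx
  · rw [dslope_same, Polynomial.deriv]
    simp only [derivative_X, derivative_X_pow_succ, Nat.cast_ofNat, map_add,
      map_one, eval_add, eval_one, eval_mul, eval_C, eval_pow, eval_X]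
    ring
  · have hyx' : y - x ≠ 0 := sub_ne_zero.2 hyx
    simp only [dslope_of_ne _ hyx, slope_def_field, eval_add, eval_X, eval_pow]
    field_simp
    ring

/-- The polynomial is the determinant of the Loewner matrix of `X + X ^ 3 + X ^ 4` at `x` and `y`
divided by `(x - y) ^ 2`. -/
lemma quartic_cofactor_nonneg {x y : ℝ} (hx : x ∈ Icc (0 : ℝ) (3 / 8))
    (hy : y ∈ Icc (0 : ℝ) (3 / 8)) :
    0 ≤ (1 + (x + y) - (x + y) ^ 2) ^ 2 - 2 * (x + y) ^ 4
      - 2 * (x * y) * (1 + (x + y) + 2 * (x * y)) := by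
  obtain ⟨hx0, hx1⟩ := hx
  obtain ⟨hy0, hy1⟩ := hy
  have hq : x * y ≤ (x + y) ^ 2 / 4 := by nlinarith [sq_nonneg (x - y)]
  have hq0 : 0 ≤ x * y := mul_nonneg hx0 hy0
  have hs0 : 0 ≤ x + y := add_nonneg hx0 hy0
  have hs1 : x + y ≤ 3 / 4 := by linarith
  generalize x + y = s at *
  generalize x * y = q at *
  calc 0 ≤ (1 + s - s ^ 2) ^ 2 - 2 * s ^ 4 - 2 * (s ^ 2 / 4) * (1 + s + 2 * (s ^ 2 / 4)) := by
        nlinarith [pow_nonneg hs0 3, pow_nonneg hs0 2,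
          mul_nonneg (pow_nonneg hs0 2) (sub_nonneg.2 hs1),
          mul_nonneg (pow_nonneg hs0 3) (sub_nonneg.2 hs1)]
    _ ≤ (1 + s - s ^ 2) ^ 2 - 2 * s ^ 4 - 2 * q * (1 + s + 2 * q) := by gcongr

lemma dslope_quartic_sq_le {x y : ℝ} (hx : x ∈ Icc (0 : ℝ) (3 / 8))
    (hy : y ∈ Icc (0 : ℝ) (3 / 8)) :
    dslope (X + X ^ 3 + X ^ 4 : ℝ[X]).eval x y ^ 2 ≤
      dslope (X + X ^ 3 + X ^ 4 : ℝ[X]).eval x x * dslope (X + X ^ 3 + X ^ 4 : ℝ[X]).eval y y := by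
  simp only [dslope_quartic]
  linear_combination (x - y) ^ 2 * quartic_cofactor_nonneg hx hy

lemma deriv_quartic_nonneg {x : ℝ} (hx : 0 ≤ x) :
    0 ≤ deriv (X + X ^ 3 + X ^ 4 : ℝ[X]).eval x := by
  rw [← dslope_same, dslope_quartic]
  positivity

theorem isMatrixMonotoneOn_quartic :
    IsMatrixMonotoneOn 2 (Icc 0 (3 / 8)) (X + X ^ 3 + X ^ 4 : ℝ[X]).eval := by
  refine isMatrixMonotoneOn_of_posSemidef_loewnerMatrix ordConnected_Icc fun d hd => ?_
  refine posSemidef_loewnerMatrix_fin_two (deriv_quartic_nonneg (hd 0).1)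
    (deriv_quartic_nonneg (hd 1).1) ?_
  simpa only [dslope_same] using dslope_quartic_sq_le (hd 0) (hd 1)

end Quartic

theorem not_isMatrixConvexOn_quintic :
    ¬ IsMatrixConvexOn 2 (Icc 0 (7 / 19)) (X ^ 2 + X ^ 4 + X ^ 5 : ℝ[X]).eval := by
  intro hconvex
  set p : ℝ[X] := X ^ 2 + X ^ 4 + X ^ 5
  -- `A` arises from `B` by a rank-one step at spectra where Kraus's condition for `p` fails.
  let A : Matrix (Fin 2) (Fin 2) ℂ :=
    !![((5 / 19 : ℝ) : ℂ), -1 / 19; star (-1 / 19), (6 / 19 : ℝ)]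
  let B : Matrix (Fin 2) (Fin 2) ℂ := !![((6 / 19 : ℝ) : ℂ), 0; star 0, (7 / 19 : ℝ)]
  have hA : spectrum ℝ A ⊆ Icc 0 (7 / 19) := by
    apply spectrum_fin_two_subset_Icc <;> norm_num
  have hB : spectrum ℝ B ⊆ Icc 0 (7 / 19) := by
    apply spectrum_fin_two_subset_Icc <;> norm_num
  have hgap := hconvex.posSemidef_aeval (isHermitian_fin_two _ _ _) (isHermitian_fin_two _ _ _)
    hA hB (c := 1 / 2) ⟨by norm_num, by norm_num⟩
  have hmid : (1 / 2 : ℝ) • A + (1 - 1 / 2 : ℝ) • B = !![11 / 38, -1 / 38; -1 / 38, 13 / 38] := by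
    ext i j
    fin_cases i <;> fin_cases j <;> norm_num [A, B]
  have hgap_eq : (1 / 2 : ℝ) • aeval A p + (1 - 1 / 2 : ℝ) • aeval B p -
      aeval ((1 / 2 : ℝ) • A + (1 - 1 / 2 : ℝ) • B) p =
        (8 * 19 ^ 5 : ℂ)⁻¹ • !![45183, 48165; 48165, 51341] := by
    rw [hmid]
    ext i j
    fin_cases i <;> fin_cases j <;> norm_num [p, A, B, pow_succ]
  have hdet := hgap.det_nonneg
  rw [hgap_eq, det_smul, det_fin_two_of] at hdet
  have hdet_re := (Complex.le_def.1 hdet).1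
  norm_num at hdet_re

theorem mainTheorem6 :
    ∃ (P : Polynomial ℝ) (β : ℝ), P.natDegree = 5 ∧ 0 < β ∧
      ∀ α : ℝ, 0 < α → ∃ g : ℝ → ℝ,
        (∀ t ∈ Set.Ico (0 : ℝ) α, t * g t = P.eval (β / α * t)) ∧
        IsMatrixMonotoneOn 2 (Set.Ioo 0 α) g ∧
        ¬ IsMatrixConvexOn 2 (Set.Ico 0 α) (fun t => t * g t) := by
  refine ⟨X ^ 2 + X ^ 4 + X ^ 5, 3 / 8, by compute_degree!, by norm_num, fun α hα => ?_⟩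
  set k := 3 / 8 / α
  have hk0 : 0 < k := by positivity
  have hkα : k * α = 3 / 8 := div_mul_cancel₀ _ hα.ne'
  set g : ℝ → ℝ := fun t => k * (X + X ^ 3 + X ^ 4 : ℝ[X]).eval (k * t)
  have hg (t : ℝ) : t * g t = (X ^ 2 + X ^ 4 + X ^ 5 : ℝ[X]).eval (k * t) := by
    simp only [g, eval_add, eval_pow, eval_X]
    ring
  refine ⟨g, fun t _ => hg t, ?_, fun hconvex => not_isMatrixConvexOn_quintic ?_⟩
  · refine (isMatrixMonotoneOn_quartic.comp_const_mul hk0 fun t ht => ?_).const_mul hk0.le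
    exact ⟨mul_nonneg hk0.le ht.1.le, hkα ▸ mul_le_mul_of_nonneg_left ht.2.le hk0.le⟩
  · have hmaps : MapsTo (k⁻¹ * ·) (Icc 0 (7 / 19)) (Ico 0 α) := fun t ht =>
      ⟨mul_nonneg (inv_nonneg.2 hk0.le) ht.1, by
        rw [inv_mul_lt_iff₀ hk0, hkα]
        linarith [ht.2]⟩
    simpa only [hg, mul_inv_cancel_left₀ hk0.ne'] using
      hconvex.comp_const_mul (inv_ne_zero hk0.ne') hmaps
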